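/- Let $r>0$, $\theta\in\mathbb{R}$, $\sigma>0$, $\mu\in\mathbb{R}$, and put $\nu=\frac{r-1}{2}$, $\alpha=\frac{\sqrt{\theta^2+\sigma^2}}{\sigma^2}$, $\beta=\frac{\theta}{\sigma^2}$. For $x>0$ let $$I_\nu(x)=\sum_{k=0}^\infty\frac{(x/2)^{\nu+2k}}{\Gamma(\nu+k+1)\,k!},\qquad K_\nu(x)=\int_0^\infty \mathrm{e}^{-x\cosh t}\cosh(\nu t)\,\mathrm{d}t$$ be the modified Bessel functions. Let $Z$ have the variance-gamma distribution $\mathrm{VG}(r,\theta,\sigma,\mu)$, that is, the distribution on $\mathbb{R}$ with density $$p(x)=\frac{1}{\sigma\sqrt{\pi}\,\Gamma(r/2)}\,\mathrm{e}^{\beta(x-\mu)}\left(\frac{|x-\mu|}{2\sqrt{\theta^2+\sigma^2}}\right)^{\nu}K_\nu(\alpha|x-\mu|).$$ For a Lipschitz function $h:\mathbb{R}\to\mathbb{R}$ write $\tilde h(x)=h(x)-\mathbb{E}h(Z)$, and let $f=f_h$ be the solution of the $\mathrm{VG}(r,\theta,\sigma,\mu)$ Stein equation $$\sigma^2(x-\mu)f''(x)+\big(\sigma^2r+2\theta(x-\mu)\big)f'(x)+\big(r\theta-(x-\mu)\big)f(x)=\tilde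 h(x)$$ given, for $x\neq\mu$ and with $y=x-\mu$, by $$f_h(x)=-\frac{\mathrm{e}^{-\beta y}K_\nu(\alpha|y|)}{\sigma^2|y|^\nu}\int_0^y \mathrm{e}^{\beta t}|t|^\nu I_\nu(\alpha|t|)\,\tilde h(t+\mu)\,\mathrm{d}t-\frac{\mathrm{e}^{-\beta y}I_\nu(\alpha|y|)}{\sigma^2|y|^\nu}\int_y^\infty \mathrm{e}^{\beta t}|t|^\nu K_\nu(\alpha|t|)\,\tilde h(t+\mu)\,\mathrm{d}t,$$ and extended to $x=\mu$ by continuity. Let $\|\cdot\|$ denote the supremum norm on $\mathbb{R}$, where for $h'$ and $f_h^{(3)}$ the supremum is taken over the points at which the derivative exists. Then there is no constant $M>0$ (depending only on the parameters $r,\theta,\sigma,\mu$) such that the bound $\|f_h^{(3)}\|\le M\|h'\|$ holds for all Lipschitz $h:\mathbb{R}\to\mathbb{R}$. -/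

import Mathlib

noncomputable section

namespace VarianceGamma

/-- The modified Bessel function of the first kind `I_ν(x)`, for `x > 0`.
(`Real.Gamma` is `0` at its poles, so there `1 / Γ = 0`, as usual.) -/
def besselI (ν x : ℝ) : ℝ :=
  ∑' k : ℕ, (x / 2) ^ (ν + 2 * (k : ℝ)) / (Real.Gamma (ν + k + 1) * (k.factorial : ℝ))

/-- The modified Bessel function of the second kind `K_ν(x)`, for `x > 0`. -/
def besselK (ν x : ℝ) : ℝ :=
  ∫ t in Set.Ioi (0 : ℝ), Real.exp (-x * Real.cosh t) * Real.cosh (ν * t)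

/-- The density of the variance-gamma distribution `VG(r, θ, σ, μ)`. -/
def density (r θ σ μ x : ℝ) : ℝ :=
  1 / (σ * √Real.pi * Real.Gamma (r / 2)) * Real.exp (θ / σ ^ 2 * (x - μ)) *
    (|x - μ| / (2 * √(θ ^ 2 + σ ^ 2))) ^ ((r - 1) / 2) *
    besselK ((r - 1) / 2) (√(θ ^ 2 + σ ^ 2) / σ ^ 2 * |x - μ|)

/-- The expectation `𝔼 h(Z)` for `Z ∼ VG(r, θ, σ, μ)`. -/
def expectation (r θ σ μ : ℝ) (h : ℝ → ℝ) : ℝ :=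
  ∫ z, h z * density r θ σ μ z

/-- The centred test function `h̃(x) = h(x) - 𝔼 h(Z)`, where `Z ∼ VG(r, θ, σ, μ)`. -/
def centred (r θ σ μ : ℝ) (h : ℝ → ℝ) (x : ℝ) : ℝ :=
  h x - expectation r θ σ μ h

/-- The solution of the `VG(r, θ, σ, μ)` Stein equation
`σ²(x-μ) f''(x) + (σ² r + 2θ(x-μ)) f'(x) + (rθ - (x-μ)) f(x) = h̃(x)` with test function `h`,
as a function of `y = x - μ`. With `ν = (r-1)/2`, `α = √(θ²+σ²)/σ²` and `β = θ/σ²` it is,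
for `y ≠ 0`,
`- e^{-βy} / (σ² |y|^ν) * K_ν(α|y|) * ∫_0^y e^{βt} |t|^ν I_ν(α|t|) h̃(t+μ) dt`
`- e^{-βy} / (σ² |y|^ν) * I_ν(α|y|) * ∫_y^∞ e^{βt} |t|^ν K_ν(α|t|) h̃(t+μ) dt`.
At `y = 0`, where `K_ν(α|y|)` is infinite, the value is the limit of this formula as `y → 0`:
the first term tends to `0`, and `I_ν(α|y|) / |y|^ν` tends to `(α/2)^ν / Γ(ν+1)`. -/
def steinSolutionAux (r θ σ μ : ℝ) (h : ℝ → ℝ) (y : ℝ) : ℝ :=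
  let ν : ℝ := (r - 1) / 2
  let α : ℝ := √(θ ^ 2 + σ ^ 2) / σ ^ 2
  let β : ℝ := θ / σ ^ 2
  if y = 0 then
    -((α / 2) ^ ν / (σ ^ 2 * Real.Gamma (ν + 1)) *
        ∫ t in Set.Ioi (0 : ℝ),
          Real.exp (β * t) * |t| ^ ν * besselK ν (α * |t|) * centred r θ σ μ h (t + μ))
  else
    -(Real.exp (-β * y) / (σ ^ 2 * |y| ^ ν) * besselK ν (α * |y|) *
        ∫ t in (0 : ℝ)..y,
          Real.exp (β * t) * |t| ^ ν * besselI ν (α * |t|) * centred r θ σ μ h (t + μ))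
    - Real.exp (-β * y) / (σ ^ 2 * |y| ^ ν) * besselI ν (α * |y|) *
        ∫ t in Set.Ioi y,
          Real.exp (β * t) * |t| ^ ν * besselK ν (α * |t|) * centred r θ σ μ h (t + μ)

/-- The solution `f` of the `VG(r, θ, σ, μ)` Stein equation with test function `h`. -/
def steinSolution (r θ σ μ : ℝ) (h : ℝ → ℝ) (x : ℝ) : ℝ :=
  steinSolutionAux r θ σ μ h (x - μ)

/-- The supremum norm `‖g‖ = sup_x |g(x)|`, as an element of `[0, ∞]`. When `g` is a derivative
(`deriv`, `iteratedDeriv`), points where it does not exist contribute `0`, so that this is the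
supremum of the absolute value over the points where the derivative exists. -/
def supNorm (g : ℝ → ℝ) : ENNReal :=
  ⨆ x : ℝ, ENNReal.ofReal |g x|

end VarianceGamma

end

open Set Filter Topology MeasureTheory

noncomputable section

namespace VarianceGamma

/-! ### The modified Bessel function of the second kind -/

/-! A kink in `h` at a distance `a > 0` to the right of `μ` makes the third derivative of the
solution jump there, and the jump blows up as `a → 0`. Take `h x = |x - μ - a|`, which has Lipschitz
constant 1 for every `a`. For `y > 0` the solution has the variation-of-parameters form `-A U - B
V`, so its second derivative is a C¹ function off the kink plus `w h̃`, with `w = B' Q - A' P`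
(`hasDerivAt_deriv_of_variation`). The one-sided limits of the third derivative at `a` differ by `2
w(a)`, so a bound `M` on it forces `|w a| ≤ M` (`abs_le_of_forall_abs_deriv_le`). The exponential
and power weights cancel in `w`, leaving `α/σ²` times the Bessel Wronskian `I_{ν+1} K_ν + K_{ν+1}
I_ν` at `αa` (`abs_steinSolution_wronskian_le`). That is at least a constant over `αa` near zero
(`besselI_mul_besselK_succ_ge`), so no `M` works for all `a`. -/

theorem exp_cosh_mul_cosh_le (ν : ℝ) {x : ℝ} (hx : 0 < x) {t : ℝ} (ht : 0 ≤ t) :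
    Real.exp (-x * Real.cosh t) * Real.cosh (ν * t) ≤
      Real.exp ((|ν| + 1) ^ 2 / x) * Real.exp (-t) := by
  have h1 : Real.cosh (ν * t) ≤ Real.exp (|ν| * t) := by
    rw [← Real.cosh_abs, abs_mul, abs_of_nonneg ht]
    have h0 : 0 ≤ |ν| * t := by positivity
    rw [Real.cosh_eq]
    have : Real.exp (-(|ν| * t)) ≤ Real.exp (|ν| * t) := Real.exp_le_exp.2 (by linarith)
    linarith
  have h2 : t ^ 2 / 4 ≤ Real.cosh t := by
    rw [Real.cosh_eq]
    linarith [Real.quadratic_le_exp_of_nonneg ht, Real.exp_pos (-t)]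
  calc Real.exp (-x * Real.cosh t) * Real.cosh (ν * t)
      ≤ Real.exp (-x * (t ^ 2 / 4)) * Real.exp (|ν| * t) := by
        refine mul_le_mul (Real.exp_le_exp.2 ?_) h1 (Real.cosh_pos _).le (Real.exp_pos _).le
        nlinarith
    _ ≤ _ := by
        rw [← Real.exp_add, ← Real.exp_add]
        refine Real.exp_le_exp.2 ?_
        -- Completing the square in `t` explains the constant `(|ν| + 1) ^ 2 / x`.
        have : (|ν| + 1) ^ 2 / x + -t - (-x * (t ^ 2 / 4) + |ν| * t)
            = (|ν| + 1 - x * t / 2) ^ 2 / x := by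
          field_simp
          ring
        have h3 : 0 ≤ (|ν| + 1 - x * t / 2) ^ 2 / x := by positivity
        linarith

theorem integrableOn_besselK (ν : ℝ) {x : ℝ} (hx : 0 < x) :
    IntegrableOn (fun t => Real.exp (-x * Real.cosh t) * Real.cosh (ν * t)) (Ioi 0) := by
  refine Integrable.mono' ((integrableOn_exp_neg_Ioi 0).const_mul
    (Real.exp ((|ν| + 1) ^ 2 / x))) ?_ ?_
  · exact Continuous.aestronglyMeasurable (by fun_prop)
  · refine (ae_restrict_iff' measurableSet_Ioi).2 (Eventually.of_forall fun t ht => ?_)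
    rw [Real.norm_of_nonneg (mul_nonneg (Real.exp_pos _).le (Real.cosh_pos _).le)]
    exact exp_cosh_mul_cosh_le ν hx (le_of_lt ht)

theorem cosh_mul_cosh (ν t : ℝ) :
    Real.cosh t * Real.cosh (ν * t) =
      (Real.cosh ((ν + 1) * t) + Real.cosh ((ν - 1) * t)) / 2 := by
  rw [add_mul, sub_mul, one_mul, Real.cosh_add, Real.cosh_sub]
  ring

theorem sinh_mul_sinh (ν t : ℝ) :
    Real.sinh t * Real.sinh (ν * t) =
      (Real.cosh ((ν + 1) * t) - Real.cosh ((ν - 1) * t)) / 2 := by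
  rw [add_mul, sub_mul, one_mul, Real.cosh_add, Real.cosh_sub]
  ring

theorem besselK_pos (ν : ℝ) {x : ℝ} (hx : 0 < x) : 0 < besselK ν x := by
  refine (setIntegral_pos_iff_support_of_nonneg_ae ?_ (integrableOn_besselK ν hx)).2 ?_
  · exact Eventually.of_forall fun t => mul_nonneg (Real.exp_pos _).le (Real.cosh_pos _).le
  · have : Function.support (fun t => Real.exp (-x * Real.cosh t) * Real.cosh (ν * t)) = univ :=
      eq_univ_of_forall fun t => (mul_pos (Real.exp_pos _) (Real.cosh_pos _)).ne'
    rw [this]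
    simp

/-- Differentiation under the integral sign; on `(x/2, ∞)` the integrands at `x/2` dominate. -/
theorem hasDerivAt_besselK (ν : ℝ) {x : ℝ} (hx : 0 < x) :
    HasDerivAt (besselK ν) (-(besselK (ν + 1) x + besselK (ν - 1) x) / 2) x := by
  have key := hasDerivAt_integral_of_dominated_loc_of_deriv_le (μ := volume.restrict (Ioi (0 : ℝ)))
    (F := fun y t => Real.exp (-y * Real.cosh t) * Real.cosh (ν * t))
    (F' := fun y t => -(Real.exp (-y * Real.cosh t) * Real.cosh ((ν + 1) * t) +
      Real.exp (-y * Real.cosh t) * Real.cosh ((ν - 1) * t)) / 2)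
    (bound := fun t => (Real.exp (-(x / 2) * Real.cosh t) * Real.cosh ((ν + 1) * t) +
      Real.exp (-(x / 2) * Real.cosh t) * Real.cosh ((ν - 1) * t)) / 2)
    (x₀ := x) (s := Ioi (x / 2)) (Ioi_mem_nhds (by linarith)) ?_ ?_ ?_ ?_ ?_ ?_
  · refine key.2.congr_deriv ?_
    rw [integral_div, integral_neg, integral_add (integrableOn_besselK _ hx)
      (integrableOn_besselK _ hx)]
    rfl
  · exact Eventually.of_forall fun y => Continuous.aestronglyMeasurable (by fun_prop)
  · exact integrableOn_besselK ν hx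
  · exact Continuous.aestronglyMeasurable (by fun_prop)
  · refine Eventually.of_forall fun t y hy => ?_
    have hy : x / 2 < y := hy
    have h1 : Real.exp (-y * Real.cosh t) ≤ Real.exp (-(x / 2) * Real.cosh t) :=
      Real.exp_le_exp.2 (by nlinarith [Real.cosh_pos t])
    have c1 := Real.cosh_pos ((ν + 1) * t)
    have c2 := Real.cosh_pos ((ν - 1) * t)
    rw [neg_div, norm_neg, Real.norm_of_nonneg (by positivity)]
    gcongr
  · exact ((integrableOn_besselK _ (half_pos hx)).add
      (integrableOn_besselK _ (half_pos hx))).div_const 2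
  · refine Eventually.of_forall fun t y _ => ?_
    have : HasDerivAt (fun y => Real.exp (-y * Real.cosh t) * Real.cosh (ν * t))
        (Real.exp (-y * Real.cosh t) * (-1 * Real.cosh t) * Real.cosh (ν * t)) y :=
      ((((hasDerivAt_id y).neg.mul_const (Real.cosh t))).exp).mul_const _
    refine this.congr_deriv ?_
    rw [← mul_add, mul_assoc, mul_assoc (-1 : ℝ), cosh_mul_cosh]
    ring

/-- Integrate the `t`-derivative of `exp (-x cosh t) sinh (ν t)` over the half-line; both boundary
terms vanish. -/
theorem besselK_recurrence (ν : ℝ) {x : ℝ} (hx : 0 < x) :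
    2 * ν * besselK ν x = x * (besselK (ν + 1) x - besselK (ν - 1) x) := by
  have hd : ∀ t ∈ Ioi (0 : ℝ), HasDerivAt
      (fun t => Real.exp (-x * Real.cosh t) * Real.sinh (ν * t))
      (ν * (Real.exp (-x * Real.cosh t) * Real.cosh (ν * t)) -
        x / 2 * (Real.exp (-x * Real.cosh t) * Real.cosh ((ν + 1) * t) -
          Real.exp (-x * Real.cosh t) * Real.cosh ((ν - 1) * t))) t := by
    intro t _
    have h1 : HasDerivAt (fun t => Real.exp (-x * Real.cosh t))
        (Real.exp (-x * Real.cosh t) * (-x * Real.sinh t)) t :=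
      ((Real.hasDerivAt_cosh t).const_mul (-x)).exp
    have h2 : HasDerivAt (fun t => Real.sinh (ν * t)) (Real.cosh (ν * t) * (ν * 1)) t :=
      ((hasDerivAt_id t).const_mul ν).sinh
    refine (h1.mul h2).congr_deriv ?_
    have := sinh_mul_sinh ν t
    linear_combination (-x * Real.exp (-x * Real.cosh t)) * this
  have hi0 := integrableOn_besselK ν hx
  have hi1 := integrableOn_besselK (ν + 1) hx
  have hi2 := integrableOn_besselK (ν - 1) hx
  have hi : IntegrableOn (fun t => x / 2 * (Real.exp (-x * Real.cosh t) * Real.cosh ((ν + 1) * t) -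
      Real.exp (-x * Real.cosh t) * Real.cosh ((ν - 1) * t))) (Ioi 0) :=
    (hi1.sub hi2).const_mul (x / 2)
  have key := integral_Ioi_of_hasDerivAt_of_tendsto
    (Continuous.continuousWithinAt (by fun_prop)) hd
    ((hi0.const_mul ν).sub hi) (m := 0) ?_
  · rw [integral_sub (hi0.const_mul ν) hi,
      integral_const_mul, integral_const_mul, integral_sub hi1 hi2] at key
    simp only [mul_zero, Real.sinh_zero, sub_zero] at key
    change ν * besselK ν x - x / 2 * (besselK (ν + 1) x - besselK (ν - 1) x) = 0 at key
    linarith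
  · have h0 : Tendsto (fun t : ℝ => Real.exp ((|ν| + 1) ^ 2 / x) * Real.exp (-t))
        atTop (𝓝 0) := by
      simpa using Real.tendsto_exp_neg_atTop_nhds_zero.const_mul
        (Real.exp ((|ν| + 1) ^ 2 / x))
    refine squeeze_zero_norm' ((eventually_ge_atTop 0).mono fun t ht => ?_) h0
    refine le_trans ?_ (exp_cosh_mul_cosh_le ν hx ht)
    rw [norm_mul, Real.norm_of_nonneg (Real.exp_pos _).le, Real.norm_eq_abs, Real.abs_sinh]
    gcongr
    rw [← Real.cosh_abs]
    exact (Real.sinh_lt_cosh _).le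

theorem hasDerivAt_besselK' (ν : ℝ) {x : ℝ} (hx : 0 < x) :
    HasDerivAt (besselK ν) (ν / x * besselK ν x - besselK (ν + 1) x) x := by
  refine (hasDerivAt_besselK ν hx).congr_deriv ?_
  have := besselK_recurrence ν hx
  field_simp
  linear_combination (-1 : ℝ) * this

theorem contDiffOn_besselK (n : ℕ) (ν : ℝ) : ContDiffOn ℝ n (besselK ν) (Ioi 0) := by
  induction n generalizing ν with
  | zero =>
    exact contDiffOn_zero.2 fun x hx => (hasDerivAt_besselK ν hx).continuousAt.continuousWithinAt
  | succ n ih =>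
    rw [Nat.cast_succ]
    refine (contDiffOn_succ_iff_deriv_of_isOpen isOpen_Ioi).2 ⟨fun x hx =>
      (hasDerivAt_besselK ν hx).differentiableAt.differentiableWithinAt,
      fun h => absurd h (by simp), ?_⟩
    exact (((ih (ν + 1)).add (ih (ν - 1))).neg.div_const 2).congr fun x hx =>
      (hasDerivAt_besselK ν hx).deriv

theorem besselK_le (ν : ℝ) {x y : ℝ} (hx : 0 < x) (hxy : x ≤ y) :
    besselK ν y ≤ Real.exp (-(y - x)) * besselK ν x := by
  rw [besselK, besselK, ← integral_const_mul]
  refine setIntegral_mono (integrableOn_besselK ν (hx.trans_le hxy))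
    ((integrableOn_besselK ν hx).const_mul _) fun t => ?_
  rw [← mul_assoc, ← Real.exp_add]
  have c1 := Real.cosh_pos (ν * t)
  gcongr
  nlinarith [Real.one_le_cosh t]

/-- On the unit window starting at `t = -log x`, the factor `x cosh t` stays below `e` while `cosh
(ν t)` is already of size `x ^ (-ν)`. -/
theorem le_besselK {ν : ℝ} (hν : 0 ≤ ν) {x : ℝ} (hx : 0 < x) (hx1 : x ≤ 1) :
    Real.exp (-Real.exp 1) / 2 * x ^ (-ν) ≤ besselK ν x := by
  have hl : 0 ≤ -Real.log x := by
    have := Real.log_nonpos hx.le hx1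
    linarith
  have hsub : Ioc (-Real.log x) (-Real.log x + 1) ⊆ Ioi 0 := fun t ht => lt_of_le_of_lt hl ht.1
  have hi := integrableOn_besselK ν hx
  calc Real.exp (-Real.exp 1) / 2 * x ^ (-ν)
      = ∫ _ in Ioc (-Real.log x) (-Real.log x + 1), Real.exp (-Real.exp 1) / 2 * x ^ (-ν) := by
        simp
    _ ≤ ∫ t in Ioc (-Real.log x) (-Real.log x + 1),
          Real.exp (-x * Real.cosh t) * Real.cosh (ν * t) := by
        refine setIntegral_mono_on
          (continuousOn_const.integrableOn_Icc.mono_set Ioc_subset_Icc_self) (hi.mono_set hsub) measurableSet_Ioc fun t ht => ?_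
        have ht0 : 0 < t := hsub ht
        have h1 : x * Real.cosh t ≤ Real.exp 1 := by
          have e1 : Real.cosh t ≤ Real.exp t := by
            rw [Real.cosh_eq]
            have : Real.exp (-t) ≤ Real.exp t := Real.exp_le_exp.2 (by linarith)
            linarith
          have e2 : Real.exp t ≤ Real.exp (-Real.log x + 1) := Real.exp_le_exp.2 ht.2
          rw [Real.exp_add, Real.exp_neg, Real.exp_log hx] at e2
          calc x * Real.cosh t ≤ x * (x⁻¹ * Real.exp 1) := by gcongr; exact e1.trans e2
            _ = Real.exp 1 := by field_simp
        have h2 : x ^ (-ν) / 2 ≤ Real.cosh (ν * t) := by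
          rw [Real.rpow_def_of_pos hx, Real.cosh_eq]
          have : Real.exp (Real.log x * -ν) ≤ Real.exp (ν * t) :=
            Real.exp_le_exp.2 (by nlinarith [ht.1])
          have := Real.exp_pos (-(ν * t))
          linarith
        calc Real.exp (-Real.exp 1) / 2 * x ^ (-ν) = Real.exp (-Real.exp 1) * (x ^ (-ν) / 2) := by
              ring
          _ ≤ _ := by
              gcongr
              linarith
    _ ≤ besselK ν x := setIntegral_mono_set hi (Eventually.of_forall fun t =>
        mul_nonneg (Real.exp_pos _).le (Real.cosh_pos _).le) hsub.eventuallyLE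

/-! ### The modified Bessel function of the first kind -/

/-- The entire function `J_ν` with `I_ν(x) = (x / 2) ^ ν * J_ν(x ^ 2 / 4)`. -/
def besselSeries (ν z : ℝ) : ℝ :=
  ∑' k : ℕ, z ^ k / (Real.Gamma (ν + k + 1) * (k.factorial : ℝ))

/-- From argument `ν + 2 > 1` on, the functional equation multiplies by factors at least 1; only the
first value needs separate care. -/
theorem exists_le_Gamma {ν : ℝ} (hν : -1 < ν) :
    ∃ m : ℝ, 0 < m ∧ ∀ k : ℕ, m ≤ Real.Gamma (ν + k + 1) := by
  have h1 : 0 < Real.Gamma (ν + 1) := Real.Gamma_pos_of_pos (by linarith)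
  have h2 : 0 < Real.Gamma (ν + 2) := Real.Gamma_pos_of_pos (by linarith)
  refine ⟨min (Real.Gamma (ν + 1)) (Real.Gamma (ν + 2)), lt_min h1 h2, fun k => ?_⟩
  rcases k with _ | k
  · simp
  · refine (min_le_right _ _).trans ?_
    induction k with
    | zero =>
      apply le_of_eq
      congr 1
      push_cast
      ring
    | succ k ih =>
      refine ih.trans ?_
      have hk : (0 : ℝ) ≤ k := k.cast_nonneg
      have hp : 0 < ν + ((k + 1 : ℕ) : ℝ) + 1 := by push_cast; linarith
      have : ν + ((k + 1 + 1 : ℕ) : ℝ) + 1 = (ν + ((k + 1 : ℕ) : ℝ) + 1) + 1 := by push_cast; ring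
      rw [this, Real.Gamma_add_one hp.ne']
      refine le_mul_of_one_le_left (Real.Gamma_pos_of_pos hp).le ?_
      push_cast
      linarith

theorem norm_besselSeries_term_le {ν m : ℝ} (hm : 0 < m)
    (h : ∀ k : ℕ, m ≤ Real.Gamma (ν + k + 1)) {z R : ℝ} (hz : |z| ≤ R) (k : ℕ) :
    ‖z ^ k / (Real.Gamma (ν + k + 1) * (k.factorial : ℝ))‖ ≤ m⁻¹ * (R ^ k / k.factorial) := by
  have hG := hm.trans_le (h k)
  have hk : (0 : ℝ) < k.factorial := by positivity
  rw [norm_div, norm_pow, Real.norm_eq_abs, Real.norm_of_nonneg (by positivity)]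
  calc |z| ^ k / (Real.Gamma (ν + k + 1) * k.factorial) ≤ R ^ k / (m * k.factorial) := by
        have := h k
        have hR : 0 ≤ R := (abs_nonneg z).trans hz
        gcongr
    _ = m⁻¹ * (R ^ k / k.factorial) := by field_simp

theorem summable_besselSeries {ν : ℝ} (hν : -1 < ν) (z : ℝ) :
    Summable fun k : ℕ => z ^ k / (Real.Gamma (ν + k + 1) * (k.factorial : ℝ)) := by
  obtain ⟨m, hm, h⟩ := exists_le_Gamma hν
  exact Summable.of_norm_bounded ((Real.summable_pow_div_factorial |z|).mul_left m⁻¹)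
    (norm_besselSeries_term_le hm h le_rfl)

theorem inv_Gamma_le_besselSeries {ν : ℝ} (hν : -1 < ν) {z : ℝ} (hz : 0 ≤ z) :
    (Real.Gamma (ν + 1))⁻¹ ≤ besselSeries ν z := by
  have := (summable_besselSeries hν z).le_tsum 0 fun k _ => by
    have : 0 < Real.Gamma (ν + k + 1) :=
      Real.Gamma_pos_of_pos (by have : (0 : ℝ) ≤ k := k.cast_nonneg
                                linarith)
    positivity
  simpa [besselSeries] using this

theorem hasDerivAt_besselSeries {ν : ℝ} (hν : -1 < ν) (z : ℝ) :
    HasDerivAt (besselSeries ν) (besselSeries (ν + 1) z) z := by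
  obtain ⟨m, hm, h⟩ := exists_le_Gamma (ν := ν + 1) (by linarith)
  set R := |z| + 1 with hR
  -- The constant term has zero derivative; the later bounds are shifted by one because `k / k! = 1
  -- / (k-1)!`.
  set u : ℕ → ℝ := fun k => Nat.casesOn k 0 fun j => m⁻¹ * (R ^ j / j.factorial) with hu
  have hterm : ∀ (j : ℕ) (y : ℝ),
      ((j + 1 : ℕ) : ℝ) * y ^ j / (Real.Gamma (ν + (j + 1 : ℕ) + 1) * ((j + 1).factorial : ℝ))
        = y ^ j / (Real.Gamma (ν + 1 + j + 1) * (j.factorial : ℝ)) := by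
    intro j y
    have e : ν + ((j + 1 : ℕ) : ℝ) + 1 = ν + 1 + j + 1 := by push_cast; ring
    have hj : ((j + 1 : ℕ) : ℝ) ≠ 0 := by positivity
    rw [e, Nat.factorial_succ, Nat.cast_mul, mul_left_comm, mul_div_mul_left _ _ hj]
  have hus : Summable u := (summable_nat_add_iff 1).1
    ((Real.summable_pow_div_factorial R).mul_left m⁻¹)
  have key := hasDerivAt_tsum_of_isPreconnected hus Metric.isOpen_ball
    (convex_ball (0 : ℝ) R).isPreconnected
    (g := fun (k : ℕ) (y : ℝ) => y ^ k / (Real.Gamma (ν + k + 1) * (k.factorial : ℝ)))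
    (g' := fun (k : ℕ) (y : ℝ) =>
      (k : ℝ) * y ^ (k - 1) / (Real.Gamma (ν + k + 1) * (k.factorial : ℝ)))
    (fun k y _ => (hasDerivAt_pow k y).div_const _) ?_
    (Metric.mem_ball_self (by positivity)) (summable_besselSeries hν 0)
    (y := z) (by simp [hR])
  · refine key.congr_deriv ?_
    rw [tsum_eq_zero_add' ((summable_besselSeries (ν := ν + 1) (by linarith) z).congr fun j =>
      (hterm j z).symm)]
    simp only [Nat.cast_zero, zero_mul, zero_div, zero_add]
    exact tsum_congr fun j => hterm j z
  · intro k y hy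
    rcases k with _ | j
    · simp [hu]
    · have hy' : |y| ≤ R := by simpa using (mem_ball_zero_iff.1 hy).le
      have := norm_besselSeries_term_le hm h hy' j
      rw [← hterm] at this
      exact this

theorem contDiff_besselSeries (n : ℕ) {ν : ℝ} (hν : -1 < ν) :
    ContDiff ℝ n (besselSeries ν) := by
  induction n generalizing ν with
  | zero =>
    exact contDiff_zero.2 <| continuous_iff_continuousAt.2 fun z =>
      (hasDerivAt_besselSeries hν z).continuousAt
  | succ n ih =>
    rw [Nat.cast_succ]
    refine contDiff_succ_iff_deriv.2 ⟨fun z => (hasDerivAt_besselSeries hν z).differentiableAt,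
      fun h => absurd h (by simp), ?_⟩
    rw [show deriv (besselSeries ν) = besselSeries (ν + 1) from
      funext fun z => (hasDerivAt_besselSeries hν z).deriv]
    exact ih (by linarith)

theorem besselI_eq (ν : ℝ) {x : ℝ} (hx : 0 < x) :
    besselI ν x = (x / 2) ^ ν * besselSeries ν (x ^ 2 / 4) := by
  rw [besselI, besselSeries, ← tsum_mul_left]
  refine tsum_congr fun k => ?_
  rw [Real.rpow_add (by positivity), ← Nat.cast_ofNat (R := ℝ), ← Nat.cast_mul, Real.rpow_natCast,
    pow_mul, mul_div_assoc]
  congr 3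
  push_cast
  ring

theorem hasDerivAt_besselI {ν : ℝ} (hν : -1 < ν) {x : ℝ} (hx : 0 < x) :
    HasDerivAt (besselI ν) (ν / x * besselI ν x + besselI (ν + 1) x) x := by
  have h1 : HasDerivAt (fun x : ℝ => (x / 2) ^ ν) (1 / 2 * ν * (x / 2) ^ (ν - 1)) x :=
    ((hasDerivAt_id x).div_const 2).rpow_const (Or.inl (by positivity))
  have h2 : HasDerivAt (fun x : ℝ => besselSeries ν (x ^ 2 / 4))
      (besselSeries (ν + 1) (x ^ 2 / 4) * (((2 : ℕ) : ℝ) * x ^ (2 - 1) / 4)) x :=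
    HasDerivAt.comp (h₂ := besselSeries ν) x (hasDerivAt_besselSeries hν (x ^ 2 / 4)) ((hasDerivAt_pow 2 x).div_const 4)
  refine ((h1.mul h2).congr_of_eventuallyEq ((eventually_gt_nhds hx).mono fun y hy =>
    besselI_eq ν hy)).congr_deriv ?_
  have hx2 : (0 : ℝ) < x / 2 := by positivity
  rw [besselI_eq ν hx, besselI_eq (ν + 1) hx, Real.rpow_add_one hx2.ne',
    Real.rpow_sub_one hx2.ne']
  field_simp
  ring

theorem contDiffOn_besselI (n : ℕ) {ν : ℝ} (hν : -1 < ν) :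
    ContDiffOn ℝ n (besselI ν) (Ioi 0) := by
  have h : ContDiffOn ℝ n (fun x : ℝ => (x / 2) ^ ν * besselSeries ν (x ^ 2 / 4)) (Ioi 0) := by
    refine ContDiffOn.mul (fun x hx => ?_) ?_
    · have hx : (0 : ℝ) < x := hx
      exact ((contDiffAt_id.div_const 2).rpow_const_of_ne (by positivity)).contDiffWithinAt
    · exact ((contDiff_besselSeries n hν).comp (by fun_prop)).contDiffOn
  exact h.congr fun x hx => besselI_eq ν hx

theorem le_besselI {ν : ℝ} (hν : -1 < ν) {x : ℝ} (hx : 0 < x) :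
    (Real.Gamma (ν + 1))⁻¹ * (x / 2) ^ ν ≤ besselI ν x := by
  rw [besselI_eq ν hx, mul_comm]
  gcongr
  exact inv_Gamma_le_besselSeries hν (by positivity)

theorem besselI_pos {ν : ℝ} (hν : -1 < ν) {x : ℝ} (hx : 0 < x) : 0 < besselI ν x := by
  refine lt_of_lt_of_le ?_ (le_besselI hν hx)
  have : 0 < Real.Gamma (ν + 1) := Real.Gamma_pos_of_pos (by linarith)
  positivity

/-! ### Variation of parameters and the jump of the third derivative -/

/-- A function `f = - A U - B V` with `U' = P g`, `V' = - Q g` and `A P = B Q` on `(0, ∞)` has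
second derivative `- A'' U - B'' V + (B' Q - A' P) g`. -/
theorem hasDerivAt_deriv_of_variation {A A₁ A₂ B B₁ B₂ P Q U V f g : ℝ → ℝ}
    (hA : ∀ y > 0, HasDerivAt A (A₁ y) y) (hA₁ : ∀ y > 0, HasDerivAt A₁ (A₂ y) y)
    (hB : ∀ y > 0, HasDerivAt B (B₁ y) y) (hB₁ : ∀ y > 0, HasDerivAt B₁ (B₂ y) y)
    (hU : ∀ y > 0, HasDerivAt U (P y * g y) y) (hV : ∀ y > 0, HasDerivAt V (-(Q y * g y)) y)
    (hAB : ∀ y > 0, A y * P y = B y * Q y) (hf : ∀ y > 0, f y = -(A y * U y) - B y * V y)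
    {y : ℝ} (hy : 0 < y) :
    deriv (deriv f) y =
      -(A₂ y * U y) - B₂ y * V y + (B₁ y * Q y - A₁ y * P y) * g y := by
  have h1 : ∀ y > 0, deriv f y = -(A₁ y * U y) - B₁ y * V y := fun y hy => by
    have : HasDerivAt f (-(A₁ y * U y) - B₁ y * V y) y := by
      refine ((((hA y hy).mul (hU y hy)).neg.sub ((hB y hy).mul (hV y hy))).congr_of_eventuallyEq
        ((eventually_gt_nhds hy).mono fun z hz => hf z hz)).congr_deriv ?_
      linear_combination (-g y) * hAB y hy
    exact this.deriv
  have : HasDerivAt (deriv f)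
      (-(A₂ y * U y) - B₂ y * V y + (B₁ y * Q y - A₁ y * P y) * g y) y := by
    refine ((((hA₁ y hy).mul (hU y hy)).neg.sub ((hB₁ y hy).mul (hV y hy))).congr_of_eventuallyEq
      ((eventually_gt_nhds hy).mono fun z hz => h1 z hz)).congr_deriv ?_
    ring
  exact this.deriv

/-- If the second derivative of `f` is `R + w g` where `g` has a kink of slopes `∓ 1` at `a`,
then the third derivative jumps by `2 w(a)` at `a`. -/
theorem abs_le_of_forall_abs_deriv_le {F R R₁ w w₁ : ℝ → ℝ} {a c M : ℝ} (ha : 0 < a)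
    (hF : ∀ y > 0, F y = R y + w y * (|y - a| - c))
    (hR : ∀ y > 0, y ≠ a → HasDerivAt R (R₁ y) y) (hR₁ : ContinuousAt R₁ a)
    (hw : ∀ y > 0, HasDerivAt w (w₁ y) y) (hw₁ : ContinuousAt w₁ a)
    (hM : ∀ y > 0, |deriv F y| ≤ M) : |w a| ≤ M := by
  have hwa : ContinuousAt w a := (hw a ha).continuousAt
  have key : ∀ s : ℝ, ∀ y > 0, y ≠ a → HasDerivAt (fun z => |z - a|) s y →
      deriv F y = R₁ y + (w₁ y * (|y - a| - c) + w y * s) := fun s y hy hya hs =>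
    (((hR y hy hya).add ((hw y hy).mul (hs.sub_const c))).congr_of_eventuallyEq
      ((eventually_gt_nhds hy).mono fun z hz => hF z hz)).deriv
  have lim : ∀ s : ℝ, Tendsto (fun y => |R₁ y + (w₁ y * (|y - a| - c) + w y * s)|) (𝓝 a)
      (𝓝 |R₁ a + (w₁ a * (|a - a| - c) + w a * s)|) := fun s =>
    (hR₁.add ((hw₁.mul (by fun_prop)).add (hwa.mul continuousAt_const))).abs
  have h1 : |R₁ a + (w₁ a * (|a - a| - c) + w a * 1)| ≤ M := by
    refine le_of_tendsto ((lim 1).mono_left (nhdsWithin_le_nhds (s := Ioi a))) ?_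
    filter_upwards [self_mem_nhdsWithin] with y hy
    have hy : a < y := hy
    rw [← key 1 y (ha.trans hy) hy.ne' ?_]
    · exact hM y (ha.trans hy)
    · refine (((hasDerivAt_id y).sub_const a)).congr_of_eventuallyEq ?_
      filter_upwards [eventually_gt_nhds hy] with z hz
      exact abs_of_pos (sub_pos.2 hz)
  have h2 : |R₁ a + (w₁ a * (|a - a| - c) + w a * (-1))| ≤ M := by
    refine le_of_tendsto ((lim (-1)).mono_left (nhdsWithin_le_nhds (s := Iio a))) ?_
    filter_upwards [self_mem_nhdsWithin, nhdsWithin_le_nhds (eventually_gt_nhds ha)] with y hy hy0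
    have hy : y < a := hy
    rw [← key (-1) y hy0 hy.ne ?_]
    · exact hM y hy0
    · refine (((hasDerivAt_id y).sub_const a).neg).congr_of_eventuallyEq ?_
      filter_upwards [eventually_lt_nhds hy] with z hz
      exact abs_of_neg (sub_neg.2 hz)
  -- Half the difference of the two one-sided limits is `w a`.
  rw [abs_le] at h1 h2 ⊢
  constructor <;> linarith [h1.1, h1.2, h2.1, h2.2]

theorem _root_.ContDiffOn.hasDerivAt_deriv {A : ℝ → ℝ} {n : ℕ}
    (hA : ContDiffOn ℝ ((n + 1 : ℕ) : WithTop ℕ∞) A (Ioi 0)) :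
    (∀ y > 0, HasDerivAt A (deriv A y) y) ∧ ContDiffOn ℝ n (deriv A) (Ioi 0) := by
  rw [Nat.cast_succ] at hA
  have h := (contDiffOn_succ_iff_deriv_of_isOpen isOpen_Ioi).1 hA
  exact ⟨fun y hy => ((h.1 y hy).differentiableAt (Ioi_mem_nhds hy)).hasDerivAt, h.2.2⟩

/-- Three derivatives of `A`, `B` and one of `P`, `Q` are what makes both the regular part and the
coefficient of the kink C¹ enough for the jump argument. -/
theorem abs_wronskian_le {A B P Q U V f : ℝ → ℝ} {a c M : ℝ} (ha : 0 < a)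
    (hA : ContDiffOn ℝ (3 : ℕ) A (Ioi 0)) (hB : ContDiffOn ℝ (3 : ℕ) B (Ioi 0))
    (hP : ContDiffOn ℝ (1 : ℕ) P (Ioi 0)) (hQ : ContDiffOn ℝ (1 : ℕ) Q (Ioi 0))
    (hU : ∀ y > 0, HasDerivAt U (P y * (|y - a| - c)) y)
    (hV : ∀ y > 0, HasDerivAt V (-(Q y * (|y - a| - c))) y)
    (hAB : ∀ y > 0, A y * P y = B y * Q y) (hf : ∀ y > 0, f y = -(A y * U y) - B y * V y)
    (hM : ∀ y > 0, |deriv (deriv (deriv f)) y| ≤ M) :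
    |deriv B a * Q a - deriv A a * P a| ≤ M := by
  obtain ⟨hA0, hA'⟩ := hA.hasDerivAt_deriv
  obtain ⟨hA1, hA''⟩ := hA'.hasDerivAt_deriv
  obtain ⟨hA2, hA3⟩ := hA''.hasDerivAt_deriv
  obtain ⟨hB0, hB'⟩ := hB.hasDerivAt_deriv
  obtain ⟨hB1, hB''⟩ := hB'.hasDerivAt_deriv
  obtain ⟨hB2, hB3⟩ := hB''.hasDerivAt_deriv
  obtain ⟨hP0, hP1⟩ := hP.hasDerivAt_deriv
  obtain ⟨hQ0, hQ1⟩ := hQ.hasDerivAt_deriv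
  have cts : ∀ {u : ℝ → ℝ}, ContDiffOn ℝ (0 : ℕ) u (Ioi 0) → ContinuousAt u a := fun hu =>
    hu.continuousOn.continuousAt (Ioi_mem_nhds ha)
  have cg : ContinuousAt (fun y => |y - a| - c) a := by fun_prop
  refine abs_le_of_forall_abs_deriv_le (w := fun y => deriv B y * Q y - deriv A y * P y) ha
    (fun y hy => hasDerivAt_deriv_of_variation hA0 hA1 hB0 hB1 hU hV hAB hf hy)
    (fun y hy _ => ((hA2 y hy).mul (hU y hy)).neg.sub ((hB2 y hy).mul (hV y hy))) ?_
    (fun y hy => ((hB1 y hy).mul (hQ0 y hy)).sub ((hA1 y hy).mul (hP0 y hy))) ?_ hM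
  · exact ((((cts hA3).mul (hU a ha).continuousAt).add
      ((hA2 a ha).continuousAt.mul ((hP0 a ha).continuousAt.mul cg))).neg).sub
      (((cts hB3).mul (hV a ha).continuousAt).add
      ((hB2 a ha).continuousAt.mul ((hQ0 a ha).continuousAt.mul cg).neg))
  · exact ((((hB2 a ha).continuousAt).mul (hQ0 a ha).continuousAt).add
      ((hB1 a ha).continuousAt.mul (cts hQ1))).sub
      ((((hA2 a ha).continuousAt).mul (hP0 a ha).continuousAt).add
      ((hA1 a ha).continuousAt.mul (cts hP1)))

/-! ### Moving endpoints, the Bessel Wronskian, and integrability of the kernels -/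

theorem hasDerivAt_intervalIntegral_of_continuousOn_Ioi {F : ℝ → ℝ}
    (hF : ContinuousOn F (Ioi 0)) {y : ℝ} (hy : 0 < y) (hi : IntervalIntegrable F volume 0 y) :
    HasDerivAt (fun y => ∫ t in (0 : ℝ)..y, F t) (F y) y :=
  intervalIntegral.integral_hasDerivAt_right hi
    (hF.stronglyMeasurableAtFilter isOpen_Ioi y hy) (hF.continuousAt (Ioi_mem_nhds hy))

theorem hasDerivAt_integral_Ioi_of_continuousOn_Ioi {F : ℝ → ℝ}
    (hF : ContinuousOn F (Ioi 0)) (hi : ∀ y > 0, IntegrableOn F (Ioi y)) {y : ℝ} (hy : 0 < y) :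
    HasDerivAt (fun y => ∫ t in Ioi y, F t) (-F y) y := by
  have h1 : HasDerivAt (fun z => ∫ t in z..y, F t) (-F y) y :=
    intervalIntegral.integral_hasDerivAt_left IntervalIntegrable.refl
      (hF.stronglyMeasurableAtFilter isOpen_Ioi y hy) (hF.continuousAt (Ioi_mem_nhds hy))
  refine (h1.add_const (∫ t in Ioi y, F t)).congr_of_eventuallyEq ?_
  filter_upwards [eventually_gt_nhds hy] with z hz
  exact (intervalIntegral.integral_interval_add_Ioi (hi z hz) (hi y hy)).symm

/-- One positive product suffices: `K_{ν+1}` contributes `x ^ (-(ν+1))` and `I_ν` contributes `x ^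
ν`. -/
theorem besselI_mul_besselK_succ_ge {ν : ℝ} (hν : -1 < ν) {x : ℝ} (hx : 0 < x) (hx1 : x ≤ 1) :
    Real.exp (-Real.exp 1) / 2 * (Real.Gamma (ν + 1))⁻¹ / 2 ^ ν / x ≤
      besselI (ν + 1) x * besselK ν x + besselK (ν + 1) x * besselI ν x := by
  have h1 := le_besselK (ν := ν + 1) (by linarith) hx hx1
  have h2 := le_besselI hν hx
  have hG : 0 < Real.Gamma (ν + 1) := Real.Gamma_pos_of_pos (by linarith)
  have h3 : 0 < besselI (ν + 1) x * besselK ν x :=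
    mul_pos (besselI_pos (by linarith) hx) (besselK_pos ν hx)
  calc Real.exp (-Real.exp 1) / 2 * (Real.Gamma (ν + 1))⁻¹ / 2 ^ ν / x
      = (Real.exp (-Real.exp 1) / 2 * x ^ (-(ν + 1))) *
          ((Real.Gamma (ν + 1))⁻¹ * (x / 2) ^ ν) := by
        rw [Real.rpow_neg hx.le, Real.rpow_add_one hx.ne', Real.div_rpow hx.le zero_le_two]
        have : 0 < x ^ ν := by positivity
        field_simp
    _ ≤ besselK (ν + 1) x * besselI ν x :=
        mul_le_mul h1 h2 (by positivity) (besselK_pos _ hx).le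
    _ ≤ _ := by linarith

theorem contDiffOn_comp_const_mul {u : ℝ → ℝ} {n : ℕ} (hu : ContDiffOn ℝ n u (Ioi 0)) {α : ℝ}
    (hα : 0 < α) : ContDiffOn ℝ n (fun y => u (α * y)) (Ioi 0) :=
  hu.comp (by fun_prop) fun y hy => mul_pos hα hy

theorem contDiffOn_rpow_Ioi (ν : ℝ) (n : ℕ) : ContDiffOn ℝ n (fun y : ℝ => y ^ ν) (Ioi 0) :=
  fun _ hy => (Real.contDiffAt_rpow_const_of_ne (ne_of_gt hy)).contDiffWithinAt

theorem contDiffOn_exp_div_rpow (β s ν : ℝ) (hs : s ≠ 0) (n : ℕ) :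
    ContDiffOn ℝ n (fun y : ℝ => Real.exp (-β * y) / (s * y ^ ν)) (Ioi 0) :=
  ContDiffOn.div (by fun_prop) (contDiffOn_const.mul (contDiffOn_rpow_Ioi ν n))
    fun _ hy => mul_ne_zero hs (Real.rpow_pos_of_pos hy ν).ne'

theorem contDiffOn_exp_mul_rpow (β ν : ℝ) (n : ℕ) :
    ContDiffOn ℝ n (fun y : ℝ => Real.exp (β * y) * y ^ ν) (Ioi 0) :=
  ContDiffOn.mul (by fun_prop) (contDiffOn_rpow_Ioi ν n)

/-- The integrand is `t ^ (2ν)` times a continuous function, and `2ν > -1`. -/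
theorem intervalIntegrable_exp_mul_rpow_mul_besselI {ν α β : ℝ} (hν : -(1 / 2) < ν) (hα : 0 < α)
    {g : ℝ → ℝ} (hg : Continuous g) {y : ℝ} (hy : 0 < y) :
    IntervalIntegrable (fun t => Real.exp (β * t) * t ^ ν * besselI ν (α * t) * g t)
      volume 0 y := by
  have hJ : Continuous (besselSeries ν) := (contDiff_besselSeries 0 (by linarith)).continuous
  have h := (intervalIntegral.intervalIntegrable_rpow' (a := 0) (b := y) (r := 2 * ν)
    (by linarith)).mul_continuousOn
    (g := fun t => Real.exp (β * t) * (α / 2) ^ ν * besselSeries ν ((α * t) ^ 2 / 4) * g t)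
    (by fun_prop)
  refine h.congr fun t ht => ?_
  rw [uIoc_of_le hy.le] at ht
  have ht : 0 < t := ht.1
  have e : (α * t / 2) ^ ν = (α / 2) ^ ν * t ^ ν := by
    rw [← Real.mul_rpow (by positivity) ht.le]
    congr 1
    ring
  rw [besselI_eq ν (mul_pos hα ht), e, two_mul, Real.rpow_add ht]
  ring

theorem integrableOn_exp_mul_rpow_mul_besselK {ν α β : ℝ} (hα : 0 < α) (hβ : β < α)
    {g : ℝ → ℝ} (hg : Continuous g) (hgO : g =O[atTop] fun t : ℝ => t) {y : ℝ} (hy : 0 < y) :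
    IntegrableOn (fun t => Real.exp (β * t) * t ^ ν * besselK ν (α * t) * g t) (Ioi y) := by
  -- Of the decay rate `α - β = 4δ`, one `δ` absorbs `t ^ ν` and one absorbs `g`, leaving `2δ`.
  set δ := (α - β) / 4 with hδ
  have hδ0 : 0 < δ := by rw [hδ]; linarith
  refine integrable_of_isBigO_exp_neg (b := 2 * δ) (by positivity) ?_ ?_
  · have hc : ContinuousOn (fun t => Real.exp (β * t) * t ^ ν * besselK ν (α * t)) (Ioi 0) :=
      ((contDiffOn_exp_mul_rpow β ν 0).continuousOn).mul
        (contDiffOn_comp_const_mul (contDiffOn_besselK 0 ν) hα).continuousOn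
    exact (hc.mul hg.continuousOn).mono fun t ht => hy.trans_le ht
  · have hK : (fun t => besselK ν (α * t)) =O[atTop] fun t => Real.exp (-α * t) := by
      refine Asymptotics.IsBigO.of_bound (Real.exp α * besselK ν α) ?_
      filter_upwards [eventually_ge_atTop 1] with t ht
      have h0 : 0 < α * t := by positivity
      rw [Real.norm_of_nonneg (besselK_pos ν h0).le, Real.norm_of_nonneg (Real.exp_pos _).le]
      refine (besselK_le ν hα (by nlinarith : α ≤ α * t)).trans (le_of_eq ?_)
      rw [show -(α * t - α) = α + -α * t by ring, Real.exp_add]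
      ring
    have hr : (fun t : ℝ => t ^ ν) =O[atTop] fun t => Real.exp (δ * t) :=
      (isLittleO_rpow_exp_pos_mul_atTop ν hδ0).isBigO
    have hg' : g =O[atTop] fun t => Real.exp (δ * t) := by
      refine hgO.trans ?_
      simpa using (isLittleO_rpow_exp_pos_mul_atTop 1 hδ0).isBigO
    have := (((Asymptotics.isBigO_refl (fun t => Real.exp (β * t)) atTop).mul hr).mul hK).mul hg'
    refine this.congr_right fun t => ?_
    rw [← Real.exp_add, ← Real.exp_add, ← Real.exp_add]
    congr 1
    rw [hδ]
    ring

/-! ### The jump for the Stein solution, and the contradiction -/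

theorem abs_steinSolution_wronskian_le {ν α β s a c M : ℝ} (hν : -(1 / 2) < ν) (hα : 0 < α)
    (hβ : β < α) (hs : 0 < s) (ha : 0 < a) {f : ℝ → ℝ}
    (hf : ∀ y > 0, f y =
      -(Real.exp (-β * y) / (s * |y| ^ ν) * besselK ν (α * |y|) *
        ∫ t in (0 : ℝ)..y, Real.exp (β * t) * |t| ^ ν * besselI ν (α * |t|) * (|t - a| - c))
      - Real.exp (-β * y) / (s * |y| ^ ν) * besselI ν (α * |y|) *
        ∫ t in Ioi y, Real.exp (β * t) * |t| ^ ν * besselK ν (α * |t|) * (|t - a| - c))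
    (hM : ∀ y > 0, |deriv (deriv (deriv f)) y| ≤ M) :
    α / s * (besselI (ν + 1) (α * a) * besselK ν (α * a) +
      besselK (ν + 1) (α * a) * besselI ν (α * a)) ≤ M := by
  have hν1 : -1 < ν := by linarith
  set E : ℝ → ℝ := fun y => Real.exp (-β * y) / (s * y ^ ν) with hE
  set D : ℝ → ℝ := fun y => Real.exp (β * y) * y ^ ν with hD
  set g : ℝ → ℝ := fun y => |y - a| - c with hg
  have hgc : Continuous g := by fun_prop
  have hgO : g =O[atTop] fun t : ℝ => t := by
    refine Asymptotics.IsBigO.of_bound (1 + (|a| + |c|)) ?_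
    filter_upwards [eventually_ge_atTop 1] with t ht
    simp only [hg, Real.norm_eq_abs, abs_of_nonneg (zero_le_one.trans ht)]
    have h1 : |(|t - a| - c)| ≤ |t - a| + |c| := by
      simpa using abs_sub (|t - a|) c
    have h2 : |t - a| ≤ |t| + |a| := abs_sub t a
    rw [abs_of_nonneg (zero_le_one.trans ht)] at h2
    nlinarith [abs_nonneg a, abs_nonneg c]
  have hED : ∀ y > 0, E y * D y = s⁻¹ := fun y hy => by
    have : 0 < y ^ ν := Real.rpow_pos_of_pos hy ν
    simp only [hE, hD, neg_mul, Real.exp_neg]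
    have := Real.exp_pos (β * y)
    field_simp
  have cE : ∀ n : ℕ, ContDiffOn ℝ n E (Ioi 0) := contDiffOn_exp_div_rpow β s ν hs.ne'
  have cD : ∀ n : ℕ, ContDiffOn ℝ n D (Ioi 0) := contDiffOn_exp_mul_rpow β ν
  have cI : ∀ n : ℕ, ContDiffOn ℝ n (fun y => besselI ν (α * y)) (Ioi 0) := fun n =>
    contDiffOn_comp_const_mul (contDiffOn_besselI n hν1) hα
  have cK : ∀ n : ℕ, ContDiffOn ℝ n (fun y => besselK ν (α * y)) (Ioi 0) := fun n =>
    contDiffOn_comp_const_mul (contDiffOn_besselK n ν) hα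
  have key := abs_wronskian_le (f := f) (a := a) (c := c) (M := M)
    (A := fun y => E y * besselK ν (α * y)) (B := fun y => E y * besselI ν (α * y))
    (P := fun y => D y * besselI ν (α * y)) (Q := fun y => D y * besselK ν (α * y))
    (U := fun y => ∫ t in (0 : ℝ)..y, D t * besselI ν (α * t) * g t)
    (V := fun y => ∫ t in Ioi y, D t * besselK ν (α * t) * g t) ha
    ((cE 3).mul (cK 3)) ((cE 3).mul (cI 3)) ((cD 1).mul (cI 1)) ((cD 1).mul (cK 1))
    (fun y hy => hasDerivAt_intervalIntegral_of_continuousOn_Ioi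
      (((cD 0).mul (cI 0)).continuousOn.mul hgc.continuousOn) hy
      (intervalIntegrable_exp_mul_rpow_mul_besselI hν hα hgc hy))
    (fun y hy => hasDerivAt_integral_Ioi_of_continuousOn_Ioi
      (((cD 0).mul (cK 0)).continuousOn.mul hgc.continuousOn)
      (fun z hz => integrableOn_exp_mul_rpow_mul_besselK hα hβ hgc hgO hz) hy)
    (fun y _ => by ring) (fun y hy => ?_) hM
  · refine le_trans (le_of_eq ?_) ((le_abs_self _).trans key)
    have hαa : 0 < α * a := mul_pos hα ha
    have dE : HasDerivAt E (deriv E a) a := (cE 1).hasDerivAt_deriv.1 a ha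
    have dI : HasDerivAt (fun y => besselI ν (α * y)) _ a :=
      HasDerivAt.comp (h₂ := besselI ν) a (hasDerivAt_besselI hν1 hαa)
        ((hasDerivAt_id a).const_mul α)
    have dK : HasDerivAt (fun y => besselK ν (α * y)) _ a :=
      HasDerivAt.comp (h₂ := besselK ν) a (hasDerivAt_besselK' ν hαa)
        ((hasDerivAt_id a).const_mul α)
    have dEI : deriv (fun y => E y * besselI ν (α * y)) a = _ := (dE.mul dI).deriv
    have dEK : deriv (fun y => E y * besselK ν (α * y)) a = _ := (dE.mul dK).deriv
    -- The terms with `E'` and with `ν / x` cancel between the two products, and `E D = 1 / s`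
    -- removes the weights.
    rw [dEI, dEK, div_eq_mul_inv, ← hED a ha]
    ring
  · have e1 : ∫ t in (0 : ℝ)..y, Real.exp (β * t) * |t| ^ ν * besselI ν (α * |t|) * (|t - a| - c)
        = ∫ t in (0 : ℝ)..y, D t * besselI ν (α * t) * g t := by
      rw [intervalIntegral.integral_of_le hy.le, intervalIntegral.integral_of_le hy.le]
      refine setIntegral_congr_fun measurableSet_Ioc fun t ht => ?_
      simp only [hD, hg, abs_of_pos ht.1]
    have e2 : ∫ t in Ioi y, Real.exp (β * t) * |t| ^ ν * besselK ν (α * |t|) * (|t - a| - c)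
        = ∫ t in Ioi y, D t * besselK ν (α * t) * g t := by
      refine setIntegral_congr_fun measurableSet_Ioi fun t ht => ?_
      have ht : 0 < t := lt_trans hy ht
      simp only [hD, hg, abs_of_pos ht]
    rw [hf y hy, e1, e2, abs_of_pos hy]

theorem le_of_forall_supNorm_le {r θ σ μ M : ℝ} (hr : 0 < r) (hσ : 0 < σ) (hM : 0 < M)
    (H : ∀ h : ℝ → ℝ, (∃ L : NNReal, LipschitzWith L h) →
      supNorm (iteratedDeriv 3 (steinSolution r θ σ μ h)) ≤
        ENNReal.ofReal M * supNorm (deriv h)) {a : ℝ} (ha : 0 < a) :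
    √(θ ^ 2 + σ ^ 2) / σ ^ 2 / σ ^ 2 *
      (besselI ((r - 1) / 2 + 1) (√(θ ^ 2 + σ ^ 2) / σ ^ 2 * a) *
          besselK ((r - 1) / 2) (√(θ ^ 2 + σ ^ 2) / σ ^ 2 * a) +
        besselK ((r - 1) / 2 + 1) (√(θ ^ 2 + σ ^ 2) / σ ^ 2 * a) *
          besselI ((r - 1) / 2) (√(θ ^ 2 + σ ^ 2) / σ ^ 2 * a)) ≤ M := by
  have hσ2 : 0 < σ ^ 2 := by positivity
  set h : ℝ → ℝ := fun x => |x - μ - a| with hh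
  have hL : LipschitzWith 1 h := LipschitzWith.of_dist_le_mul fun x y => by
    simp only [hh, Real.dist_eq, NNReal.coe_one, one_mul]
    refine (abs_abs_sub_abs_le_abs_sub _ _).trans (le_of_eq ?_)
    congr 1
    ring
  have hd : supNorm (deriv h) ≤ 1 := iSup_le fun x => by
    have := norm_deriv_le_of_lipschitz (x₀ := x) hL
    simpa using this
  have hle : ∀ x, |iteratedDeriv 3 (steinSolution r θ σ μ h) x| ≤ M := fun x => by
    have h1 : ENNReal.ofReal |iteratedDeriv 3 (steinSolution r θ σ μ h) x| ≤ ENNReal.ofReal M :=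
      ((le_iSup (fun x => ENNReal.ofReal |iteratedDeriv 3 (steinSolution r θ σ μ h) x|) x).trans
        (H h ⟨1, hL⟩)).trans (by simpa using mul_le_mul_right hd (ENNReal.ofReal M))
    exact (ENNReal.ofReal_le_ofReal_iff hM.le).1 h1
  -- The expectation enters only as the constant `c`, which does not affect the jump, so it is never
  -- computed.
  refine abs_steinSolution_wronskian_le (β := θ / σ ^ 2) (c := expectation r θ σ μ h)
    (f := steinSolutionAux r θ σ μ h) (by linarith) (by positivity) ?_ hσ2 ha (fun y hy => ?_)
    (fun y _ => ?_)
  · refine div_lt_div_of_pos_right (Real.lt_sqrt_of_sq_lt (by linarith)) hσ2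
  · simp only [steinSolutionAux, if_neg hy.ne', centred, hh, add_sub_cancel_right]
  · have h1 := hle (y + μ)
    have h2 : steinSolution r θ σ μ h = fun x => steinSolutionAux r θ σ μ h (x - μ) := rfl
    rw [h2, iteratedDeriv_comp_sub_const] at h1
    simpa [iteratedDeriv_succ, iteratedDeriv_zero] using h1

end VarianceGamma

end

theorem proposition3p4 (r θ σ μ : ℝ) (hr : 0 < r) (hσ : 0 < σ) :
    ¬ ∃ M : ℝ, 0 < M ∧
      ∀ h : ℝ → ℝ, (∃ L : NNReal, LipschitzWith L h) →
        VarianceGamma.supNorm (iteratedDeriv 3 (VarianceGamma.steinSolution r θ σ μ h)) ≤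
          ENNReal.ofReal M * VarianceGamma.supNorm (deriv h) := by
  rintro ⟨M, hM, H⟩
  set α := √(θ ^ 2 + σ ^ 2) / σ ^ 2 with hα
  have hα0 : 0 < α := by positivity
  set ν := (r - 1) / 2 with hν
  have hν1 : -1 < ν := by linarith
  have hG : 0 < Real.Gamma (ν + 1) := Real.Gamma_pos_of_pos (by linarith)
  set C := Real.exp (-Real.exp 1) / 2 * (Real.Gamma (ν + 1))⁻¹ / 2 ^ ν with hC
  have hC0 : 0 < C := by positivity
  -- The cap 1 is needed for the lower bound on `K_{ν+1}`; the other entry makes the Wronskian term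
  -- at least `2 * M`.
  set x := min 1 (α / σ ^ 2 * C / (2 * M)) with hx
  have hx0 : 0 < x := lt_min one_pos (by positivity)
  have h1 := VarianceGamma.le_of_forall_supNorm_le hr hσ hM H (a := x / α) (by positivity)
  have h2 := VarianceGamma.besselI_mul_besselK_succ_ge hν1 hx0 (min_le_left _ _)
  rw [← hα, ← hν, mul_div_cancel₀ _ hα0.ne'] at h1
  have h3 : α / σ ^ 2 * (C / x) ≤ M :=
    (mul_le_mul_of_nonneg_left h2 (by positivity)).trans h1
  rw [← mul_div_assoc, div_le_iff₀ hx0] at h3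
  have h4 : x ≤ α / σ ^ 2 * C / (2 * M) := min_le_right _ _
  rw [le_div_iff₀ (by positivity)] at h4
  have : 0 < α / σ ^ 2 * C := by positivity
  linarith
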